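/- Let $H$ be a complex Hilbert space with scalar product $(\cdot,\cdot)$ (conjugate-linear in the second argument), let $\{\mathcal{U}(t)\}_{t\ge 0}$ be a strongly continuous semigroup of bounded linear operators on $H$, and let $\mathcal{L}x:=\lim_{h\searrow 0}\frac1h[\mathcal{U}(h)x-x]$ be its generator, with domain $D(\mathcal{L})$ the set of all $x\in H$ for which this limit exists; let $\mathcal{L}^\dagger$ be the adjoint of $\mathcal{L}$. Let $z\in D(\mathcal{L})\cap D(\mathcal{L}^\dagger)$ with $z\neq 0$, and put $\mathcal{P}x:=(x,z)(z,z)^{-1}z$ and $\mathcal{Q}:=1-\mathcal{P}$. Products of operators carry their natural domains: $D(\mathcal{QL})=D(\mathcal{L})$ and $D(A\mathcal{Q})=\{x\in H:\mathcal{Q}x\in D(A)\}$. Then $\mathcal{QL}$ is closable, with closure denoted $\overline{\mathcal{QL}}$; the operator $\overline{\mathcal{QL}}\,\mathcal{Q}$ generates a unique strongly continuous semigroup $\{\mathcal{G}(t)\}_{t\ge 0}$ on $H$; the operator $\mathcal{LQ}$ generates a unique strongly continuous semigroup $\{e^{\mathcal{LQ}t}\}_{t\ge 0}$ on $H$; and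 for all $t\ge 0$ $$\mathcal{G}(t)=\mathcal{P}+\mathcal{Q}e^{\mathcal{LQ}t}.$$ -/

import Mathlib

open Filter Topology
open scoped NNReal

/-- A strongly continuous one-parameter semigroup of bounded linear operators on `H`. -/
@[ext]
structure C0Semigroup (H : Type*) [NormedAddCommGroup H] [InnerProductSpace ℂ H] where
  /-- The operator at time `t ≥ 0`. -/
  op : ℝ≥0 → H →L[ℂ] H
  op_zero : op 0 = ContinuousLinearMap.id ℂ H
  op_add : ∀ s t : ℝ≥0, op (s + t) = (op s).comp (op t)
  continuous_orbit : ∀ x : H, Continuous fun t : ℝ≥0 => op t x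

namespace C0Semigroup

/-- The right derivative at `0` of the orbit map of `x` exists and equals `y`. -/
def HasGenerator {H : Type*} [NormedAddCommGroup H] [InnerProductSpace ℂ H]
    (U : C0Semigroup H) (x y : H) : Prop :=
  Tendsto (fun h : ℝ≥0 => (((h : ℝ) : ℂ)⁻¹) • (U.op h x - x)) (𝓝[>] (0 : ℝ≥0)) (𝓝 y)

theorem HasGenerator.unique {H : Type*} [NormedAddCommGroup H] [InnerProductSpace ℂ H]
    {U : C0Semigroup H} {x y y' : H} (h : U.HasGenerator x y) (h' : U.HasGenerator x y') :
    y = y' :=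
  tendsto_nhds_unique h h'

theorem HasGenerator.add {H : Type*} [NormedAddCommGroup H] [InnerProductSpace ℂ H]
    {U : C0Semigroup H} {x y x' y' : H} (h : U.HasGenerator x y) (h' : U.HasGenerator x' y') :
    U.HasGenerator (x + x') (y + y') := by
  refine (Tendsto.add h h').congr fun t => ?_
  rw [map_add, ← smul_add]
  congr 1
  abel

theorem HasGenerator.smul {H : Type*} [NormedAddCommGroup H] [InnerProductSpace ℂ H]
    {U : C0Semigroup H} {x y : H} (c : ℂ) (h : U.HasGenerator x y) :
    U.HasGenerator (c • x) (c • y) := by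
  refine (Tendsto.const_smul h c).congr fun t => ?_
  rw [map_smul, ← smul_sub, smul_comm]

theorem HasGenerator.zero {H : Type*} [NormedAddCommGroup H] [InnerProductSpace ℂ H]
    (U : C0Semigroup H) : U.HasGenerator 0 0 := by
  refine tendsto_const_nhds.congr fun t => ?_
  simp

/-- The (infinitesimal) generator `x ↦ lim_{h ↘ 0} h⁻¹ (U(h) x - x)`, an unbounded operator
whose domain is the set of all `x` for which this limit exists in `H`. -/
noncomputable def generator {H : Type*} [NormedAddCommGroup H] [InnerProductSpace ℂ H]
    (U : C0Semigroup H) : H →ₗ.[ℂ] H where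
  domain :=
    { carrier := {x | ∃ y, U.HasGenerator x y}
      add_mem' := fun ⟨_, h⟩ ⟨_, h'⟩ => ⟨_, h.add h'⟩
      zero_mem' := ⟨0, HasGenerator.zero U⟩
      smul_mem' := fun c _ ⟨_, h⟩ => ⟨_, h.smul c⟩ }
  toFun :=
    { toFun := fun x => Classical.choose x.2
      map_add' := fun x x' =>
        (Classical.choose_spec (x + x').2).unique
          ((Classical.choose_spec x.2).add (Classical.choose_spec x'.2))
      map_smul' := fun c x =>
        (Classical.choose_spec (c • x).2).unique ((Classical.choose_spec x.2).smul c) }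

theorem hasGenerator_generator {H : Type*} [NormedAddCommGroup H] [InnerProductSpace ℂ H]
    (U : C0Semigroup H) (x : U.generator.domain) : U.HasGenerator x (U.generator x) :=
  Classical.choose_spec x.2

end C0Semigroup

/-- The Mori projection `P x = (x, z) (z, z)⁻¹ z`. The scalar product `(x, y)` that is linear in
`x` and conjugate-linear in `y` is `inner ℂ y x` here. -/
noncomputable def moriP {H : Type*} [NormedAddCommGroup H] [InnerProductSpace ℂ H] (z : H) :
    H →L[ℂ] H :=
  (inner ℂ z z)⁻¹ • (innerSL ℂ z).smulRight z

theorem moriP_apply {H : Type*} [NormedAddCommGroup H] [InnerProductSpace ℂ H] (z x : H) :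
    moriP z x = (inner ℂ z x * (inner ℂ z z)⁻¹) • z := by
  simp [moriP, smul_smul, mul_comm]

/-- The complementary projection `Q = 1 - P`. -/
noncomputable def moriQ {H : Type*} [NormedAddCommGroup H] [InnerProductSpace ℂ H] (z : H) :
    H →L[ℂ] H :=
  ContinuousLinearMap.id ℂ H - moriP z

/-- The product `B A` of a bounded operator `B` with an unbounded operator `A`, on the domain
of `A`. -/
def boundedMul {H : Type*} [NormedAddCommGroup H] [InnerProductSpace ℂ H]
    (B : H →L[ℂ] H) (A : H →ₗ.[ℂ] H) : H →ₗ.[ℂ] H :=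
  (B : H →ₗ[ℂ] H).compPMap A

/-- The product `A B` of an unbounded operator `A` with a bounded operator `B`, on the natural
domain `{x | B x ∈ D(A)}`. -/
def mulBounded {H : Type*} [NormedAddCommGroup H] [InnerProductSpace ℂ H]
    (A : H →ₗ.[ℂ] H) (B : H →L[ℂ] H) : H →ₗ.[ℂ] H where
  domain := A.domain.comap (B : H →ₗ[ℂ] H)
  toFun := A.toFun.comp ((B : H →ₗ[ℂ] H).submoduleComap A.domain)

theorem mulBounded_apply {H : Type*} [NormedAddCommGroup H] [InnerProductSpace ℂ H]
    (A : H →ₗ.[ℂ] H) (B : H →L[ℂ] H) (x : (mulBounded A B).domain) :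
    mulBounded A B x = A ⟨B x, x.2⟩ :=
  rfl

/-!
Write `c(x) = (x, z) / (z, z)`. Both operators in the statement are bounded perturbations of `L`.
Since `z ∈ D(L)`, the range of `P` lies in `D(L)`, so `L Q = L - L P` on `D(L)`, where
`L P x = c(x) L z` has rank one. Since `z ∈ D(L†)`, one has `P L x = (x, L† z) (z, z)⁻¹ z` on
`D(L)`, which is again bounded of rank one; hence `Q L = L - P L` differs from the closed operator
`L` by a bounded one and is itself closed, and `(Q L) Q` is `L` plus a bounded operator, on `D(L)`.

Existence of both semigroups is then the bounded perturbation theorem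
(`C0Semigroup.exists_perturbation`). After multiplying `U(t)` by a decaying exponential, the
Volterra operator `K : f ↦ ∫₀ᵗ U(t - s) B f(s) ds` has norm `< 1` on the bounded continuous
functions on `[0, ∞)`, and applying `(1 - K)⁻¹` to the unperturbed orbits yields the perturbed
semigroup. Uniqueness is `C0Semigroup.eq_of_hasGenerator_imp`: one semigroup whose generator
extends that of another is equal to it.

For the formula, `L Q z = 0` gives `S(t) z = z` for the semigroup `S` generated by `L Q`, and this
makes `P + Q S(t)` a strongly continuous semigroup (`C0Semigroup.projected`). Its generator extends
`Q L Q`, the generator of `G`, so the two semigroups coincide.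
-/

namespace C0Semigroup

open MeasureTheory Set

variable {H : Type*} [NormedAddCommGroup H] [InnerProductSpace ℂ H]

/-! ### Semigroups on the real time axis -/

/-- The semigroup reparametrized by real times, equal to the identity for `t ≤ 0`. This makes the
interval integral and one-sided derivatives on `ℝ` available. -/
def realOp (U : C0Semigroup H) (t : ℝ) : H →L[ℂ] H :=
  U.op t.toNNReal

@[simp]
theorem realOp_coe (U : C0Semigroup H) (t : ℝ≥0) : U.realOp t = U.op t := by
  simp [realOp]

@[simp]
theorem realOp_zero_apply (U : C0Semigroup H) (x : H) : U.realOp 0 x = x := by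
  simp [realOp, U.op_zero]

theorem realOp_add_apply (U : C0Semigroup H) {s t : ℝ} (hs : 0 ≤ s) (ht : 0 ≤ t) (x : H) :
    U.realOp (s + t) x = U.realOp s (U.realOp t x) := by
  simp [realOp, Real.toNNReal_add hs ht, U.op_add]

theorem continuous_realOp_apply (U : C0Semigroup H) (x : H) :
    Continuous fun t : ℝ => U.realOp t x :=
  (U.continuous_orbit x).comp continuous_real_toNNReal

theorem ext_of_op_apply {U V : C0Semigroup H} (h : ∀ t x, U.op t x = V.op t x) : U = V :=
  C0Semigroup.ext (funext fun t => ContinuousLinearMap.ext (h t))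

/-- Local boundedness, from the uniform boundedness principle. -/
theorem exists_norm_realOp_le [CompleteSpace H] (U : C0Semigroup H) (T : ℝ) :
    ∃ C : ℝ≥0, ∀ t ≤ T, ‖U.realOp t‖ ≤ C := by
  have key : ∃ C, ∀ t : Icc (0 : ℝ) (max T 0), ‖U.realOp t‖ ≤ C := by
    refine banach_steinhaus fun x => ?_
    obtain ⟨C, hC⟩ := (isCompact_Icc (a := (0 : ℝ)) (b := max T 0)).exists_bound_of_continuousOn
      (U.continuous_realOp_apply x).continuousOn
    exact ⟨C, fun t => hC t t.2⟩
  obtain ⟨C, hC⟩ := key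
  have hC0 : 0 ≤ C := (norm_nonneg _).trans (hC ⟨0, le_rfl, le_max_right _ _⟩)
  refine ⟨⟨C, hC0⟩, fun t ht => ?_⟩
  have h := hC ⟨max t 0, le_max_right _ _, max_le_max_right 0 ht⟩
  have e : U.realOp (max t 0) = U.realOp t := by
    simp only [realOp]
    congr 1
    ext
    simp
  rw [e] at h
  exact h

/-- Exponential growth bound: split `t` into `⌊t⌋` unit steps and a remainder. -/
theorem exists_norm_realOp_le_exp [CompleteSpace H] (U : C0Semigroup H) :
    ∃ M ω : ℝ, 0 ≤ M ∧ ∀ t, 0 ≤ t → ‖U.realOp t‖ ≤ M * Real.exp (ω * t) := by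
  obtain ⟨C, hC⟩ := U.exists_norm_realOp_le 1
  set M : ℝ := max C 1
  have hM : 1 ≤ M := le_max_right _ _
  have hM' : ∀ t ≤ 1, ‖U.realOp t‖ ≤ M := fun t ht => (hC t ht).trans (le_max_left _ _)
  have hpow : ∀ n : ℕ, ∀ t : ℝ, 0 ≤ t → t ≤ 1 → ‖U.realOp (n + t)‖ ≤ M * M ^ n := by
    intro n
    induction n with
    | zero => intro t _ ht; simpa using hM' t ht
    | succ n ih =>
      intro t h0 h1
      have e : U.realOp ((n + 1 : ℕ) + t) = (U.realOp 1).comp (U.realOp (n + t)) := by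
        ext x
        rw [ContinuousLinearMap.comp_apply, ← U.realOp_add_apply zero_le_one (by positivity)]
        congr 2
        push_cast
        ring
      rw [e, pow_succ, mul_comm (M ^ n), mul_left_comm]
      exact (ContinuousLinearMap.opNorm_comp_le _ _).trans
        (mul_le_mul (hM' 1 le_rfl) (ih t h0 h1) (norm_nonneg _) (by positivity))
  refine ⟨M, Real.log M, by positivity, fun t ht => ?_⟩
  have h := hpow ⌊t⌋₊ (t - ⌊t⌋₊) (sub_nonneg.2 (Nat.floor_le ht))
    (by linarith [Nat.lt_floor_add_one t])
  rw [add_sub_cancel] at h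
  refine h.trans (mul_le_mul_of_nonneg_left ?_ (by positivity))
  rw [← Real.rpow_def_of_pos (by positivity), ← Real.rpow_natCast]
  exact Real.rpow_le_rpow_of_exponent_le hM (Nat.floor_le ht)

theorem continuous_realOp_uncurry [CompleteSpace H] (U : C0Semigroup H) :
    Continuous fun p : ℝ × H => U.realOp p.1 p.2 := by
  refine continuous_iff_continuousAt.2 fun p => ?_
  obtain ⟨C, hC⟩ := U.exists_norm_realOp_le (p.1 + 1)
  have h : ContinuousOn (fun q : ℝ × H => U.realOp q.1 q.2) (Iio (p.1 + 1) ×ˢ univ) := by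
    refine continuousOn_prod_of_continuousOn_lipschitzOnWith' _ C (fun t ht => ?_)
      (fun x _ => (U.continuous_realOp_apply x).continuousOn)
    refine ((U.realOp t).lipschitz.weaken ?_).lipschitzOnWith
    exact_mod_cast hC t (mem_Iio.1 ht).le
  exact h.continuousAt (prod_mem_nhds (Iio_mem_nhds (by linarith)) univ_mem)

theorem continuous_realOp_comp [CompleteSpace H] (U : C0Semigroup H) {X : Type*}
    [TopologicalSpace X] {τ : X → ℝ} {f : X → H} (hτ : Continuous τ) (hf : Continuous f) :
    Continuous fun p => U.realOp (τ p) (f p) :=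
  U.continuous_realOp_uncurry.comp (hτ.prodMk hf)

/-! ### The generator -/

theorem map_coe_nhdsGT_zero :
    map ((↑) : ℝ≥0 → ℝ) (𝓝[>] 0) = 𝓝[>] 0 := by
  have h := NNReal.isEmbedding_coe.map_nhdsWithin_eq (Ioi (0 : ℝ≥0)) 0
  rw [h]
  congr 1
  ext t
  constructor
  · rintro ⟨s, hs, rfl⟩
    exact_mod_cast hs
  · intro ht
    exact ⟨⟨t, le_of_lt ht⟩, ht, rfl⟩

theorem hasGenerator_iff_hasDerivWithinAt {U : C0Semigroup H} {x y : H} :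
    U.HasGenerator x y ↔ HasDerivWithinAt (fun t : ℝ => U.realOp t x) y (Ioi 0) 0 := by
  rw [hasDerivWithinAt_iff_tendsto_slope' self_notMem_Ioi, ← map_coe_nhdsGT_zero, tendsto_map'_iff,
    HasGenerator]
  refine tendsto_congr fun t => ?_
  rw [Function.comp_apply, slope_def_module, realOp_coe, realOp_zero_apply, sub_zero,
    ← Complex.ofReal_inv, Complex.coe_smul]

theorem HasGenerator.realOp {U : C0Semigroup H} {x y : H} (h : U.HasGenerator x y)
    {t : ℝ} (ht : 0 ≤ t) : U.HasGenerator (U.realOp t x) (U.realOp t y) := by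
  refine (((U.realOp t).continuous.tendsto y).comp h).congr fun s => ?_
  have e : U.op s (U.realOp t x) = U.realOp t (U.op s x) := by
    rw [← realOp_coe, ← U.realOp_add_apply s.coe_nonneg ht,
      ← U.realOp_add_apply ht s.coe_nonneg, add_comm]
  simp [e]

/-- The right derivative at `0` transported to an arbitrary starting time `t`. -/
theorem HasGenerator.hasDerivWithinAt_sub {U : C0Semigroup H} {x y : H} (h : U.HasGenerator x y)
    (t : ℝ) : HasDerivWithinAt (fun s : ℝ => U.realOp (s - t) x) y (Ioi t) t := by
  have h0 := hasGenerator_iff_hasDerivWithinAt.1 h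
  have := HasDerivWithinAt.scomp (h := fun s : ℝ => s - t) (s := Ioi t) (t' := Ioi 0) t
    (g₁ := fun s : ℝ => U.realOp s x) (h' := 1) (g₁' := y) (by simpa using h0)
    ((hasDerivAt_id t).sub_const t).hasDerivWithinAt (fun s hs => by simpa using hs)
  rw [one_smul] at this
  exact this

theorem HasGenerator.hasDerivWithinAt {U : C0Semigroup H} {x y : H} (h : U.HasGenerator x y)
    {t : ℝ} (ht : 0 ≤ t) :
    HasDerivWithinAt (fun s : ℝ => U.realOp s x) (U.realOp t y) (Ioi t) t := by
  refine ((h.realOp ht).hasDerivWithinAt_sub t).congr (fun s hs => ?_) (by simp)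
  rw [← U.realOp_add_apply (sub_nonneg.2 (le_of_lt hs)) ht, sub_add_cancel]

theorem HasGenerator.integral_eq {U : C0Semigroup H} {x y : H} [CompleteSpace H]
    (h : U.HasGenerator x y) {t : ℝ} (ht : 0 ≤ t) :
    ∫ s in (0 : ℝ)..t, U.realOp s y = U.realOp t x - x := by
  rw [intervalIntegral.integral_eq_sub_of_hasDeriv_right
    (U.continuous_realOp_apply x).continuousOn (fun s hs => ?_)
    ((U.continuous_realOp_apply y).intervalIntegrable _ _), realOp_zero_apply]
  rw [min_eq_left ht] at hs
  exact h.hasDerivWithinAt hs.1.le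

theorem hasDerivAt_integral_realOp [CompleteSpace H] (U : C0Semigroup H) (x : H) (t : ℝ) :
    HasDerivAt (fun t => ∫ s in (0 : ℝ)..t, U.realOp s x) (U.realOp t x) t :=
  intervalIntegral.integral_hasDerivAt_right
    ((U.continuous_realOp_apply x).intervalIntegrable _ _)
    ((U.continuous_realOp_apply x).stronglyMeasurableAtFilter _ _)
    (U.continuous_realOp_apply x).continuousAt

/-- The generator relation in integrated form. The right-hand side is stable under limits in
`(x, y)`, which is why the generator is closed. -/
theorem hasGenerator_iff_integral_eq [CompleteSpace H] {U : C0Semigroup H} {x y : H} :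
    U.HasGenerator x y ↔
      ∀ t : ℝ, 0 ≤ t → ∫ s in (0 : ℝ)..t, U.realOp s y = U.realOp t x - x := by
  refine ⟨fun h t ht => h.integral_eq ht, fun h => hasGenerator_iff_hasDerivWithinAt.2 ?_⟩
  have h0 := ((U.hasDerivAt_integral_realOp y 0).add_const x).hasDerivWithinAt (s := Ioi 0)
  rw [realOp_zero_apply] at h0
  refine h0.congr (fun t ht => ?_) (by simp)
  rw [h t (le_of_lt ht), sub_add_cancel]

theorem continuous_integral_realOp [CompleteSpace H] (U : C0Semigroup H) (t : ℝ) :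
    Continuous fun y => ∫ s in (0 : ℝ)..t, U.realOp s y :=
  intervalIntegral.continuous_parametric_intervalIntegral_of_continuous'
    (U.continuous_realOp_comp continuous_snd continuous_fst) _ _

/-- The generator of a strongly continuous semigroup is a closed operator. -/
theorem isClosed_setOf_hasGenerator [CompleteSpace H] (U : C0Semigroup H) :
    IsClosed {p : H × H | U.HasGenerator p.1 p.2} := by
  simp only [hasGenerator_iff_integral_eq, ofPred_forall]
  refine isClosed_iInter fun t => isClosed_iInter fun _ => isClosed_eq ?_ ?_
  · exact (U.continuous_integral_realOp t).comp continuous_snd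
  · exact ((U.realOp t).continuous.comp continuous_fst).sub continuous_fst

/-- Time averages of orbits lie in the domain of the generator. -/
theorem hasGenerator_integral_realOp [CompleteSpace H] (U : C0Semigroup H) (x : H) {t : ℝ}
    (ht : 0 ≤ t) :
    U.HasGenerator (∫ s in (0 : ℝ)..t, U.realOp s x) (U.realOp t x - x) := by
  have hint : ∀ a b, IntervalIntegrable (fun s => U.realOp s x) volume a b :=
    fun a b => (U.continuous_realOp_apply x).intervalIntegrable a b
  rw [hasGenerator_iff_hasDerivWithinAt]
  have h1 : HasDerivAt (fun r : ℝ => ∫ s in (0 : ℝ)..(r + t), U.realOp s x) (U.realOp t x) 0 := by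
    have := (U.hasDerivAt_integral_realOp x (0 + t)).comp_add_const 0 t
    simpa using this
  have h2 := (h1.sub (U.hasDerivAt_integral_realOp x 0)).hasDerivWithinAt (s := Ioi 0)
  rw [realOp_zero_apply] at h2
  have e : ∀ r, 0 ≤ r → U.realOp r (∫ s in (0 : ℝ)..t, U.realOp s x) =
      (∫ s in (0 : ℝ)..(r + t), U.realOp s x) - ∫ s in (0 : ℝ)..r, U.realOp s x := by
    intro r hr
    rw [intervalIntegral.integral_interval_sub_left (hint _ _) (hint _ _),
      ← ContinuousLinearMap.intervalIntegral_comp_comm _ (hint _ _)]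
    have hshift := intervalIntegral.integral_comp_add_left (a := 0) (b := t)
      (fun s => U.realOp s x) r
    rw [add_zero] at hshift
    rw [← hshift]
    refine intervalIntegral.integral_congr fun s hs => ?_
    rw [uIcc_of_le ht] at hs
    exact (U.realOp_add_apply hr hs.1 x).symm
  exact h2.congr (fun r hr => e r (le_of_lt hr)) (e 0 le_rfl)

/-- The generator is densely defined: `x` is the limit of its time averages over `[0, t]`. -/
theorem dense_setOf_hasGenerator [CompleteSpace H] (U : C0Semigroup H) :
    Dense {x | ∃ y, U.HasGenerator x y} := by
  intro x
  have h0 : Tendsto (fun t : ℝ => t⁻¹ • ∫ s in (0 : ℝ)..t, U.realOp s x) (𝓝[>] 0) (𝓝 x) := by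
    have := ((U.hasDerivAt_integral_realOp x 0).hasDerivWithinAt (s := Ioi 0))
    rw [hasDerivWithinAt_iff_tendsto_slope' self_notMem_Ioi, realOp_zero_apply] at this
    refine this.congr fun t => ?_
    simp [slope_def_module]
  refine mem_closure_of_tendsto h0 (eventually_mem_nhdsWithin.mono fun t ht => ?_)
  refine ⟨((t⁻¹ : ℝ) : ℂ) • (U.realOp t x - x), ?_⟩
  rw [← Complex.coe_smul]
  exact (U.hasGenerator_integral_realOp x (le_of_lt ht)).smul _

/-- A semigroup is determined by its generator; even an inclusion of generators forces equality.
For `x` in the domain of the smaller one, the path `s ↦ V(t - s) U(s) x` joins `V(t) x` to `U(t) x`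
and has zero right derivative. -/
theorem eq_of_hasGenerator_imp [CompleteSpace H] {U V : C0Semigroup H}
    (h : ∀ x y, U.HasGenerator x y → V.HasGenerator x y) : U = V := by
  have key : ∀ t : ℝ, 0 ≤ t → ∀ x y, U.HasGenerator x y → U.realOp t x = V.realOp t x := by
    intro t ht x y hxy
    have hcont : Continuous fun s : ℝ => V.realOp (t - s) (U.realOp s x) :=
      V.continuous_realOp_comp (by fun_prop) (U.continuous_realOp_apply x)
    obtain ⟨C, hC⟩ := V.exists_norm_realOp_le t
    have hderiv : ∀ s ∈ Ico 0 t,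
        HasDerivWithinAt (fun s : ℝ => V.realOp (t - s) (U.realOp s x)) 0 (Ici s) s := by
      intro s hs
      rw [← hasDerivWithinAt_Ioi_iff_Ici]
      -- `U` and `V` have the same right derivative at `w`, and the increment of the path is
      -- `V (t - r)` applied to the difference of the two orbits of `w`.
      set w := U.realOp s x
      have hw := hxy.realOp hs.1
      have hd := (hw.hasDerivWithinAt_sub s).sub ((h _ _ hw).hasDerivWithinAt_sub s)
      rw [sub_self] at hd
      rw [hasDerivWithinAt_iff_isLittleO] at hd ⊢
      refine Asymptotics.IsBigO.trans_isLittleO (Asymptotics.IsBigO.of_bound C ?_) hd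
      filter_upwards [Ioo_mem_nhdsGT hs.2] with r hr
      have e1 : U.realOp r x = U.realOp (r - s) w := by
        rw [← U.realOp_add_apply (sub_nonneg.2 hr.1.le) hs.1, sub_add_cancel]
      have e2 : V.realOp (t - s) w = V.realOp (t - r) (V.realOp (r - s) w) := by
        rw [← V.realOp_add_apply (sub_nonneg.2 hr.2.le) (sub_nonneg.2 hr.1.le)]
        congr 2
        ring
      rw [e1, e2]
      simp only [smul_zero, sub_zero, Pi.sub_apply, sub_self, realOp_zero_apply]
      rw [← map_sub]
      exact (V.realOp (t - r)).le_of_opNorm_le (hC _ (by linarith [hs.1, hr.1])) _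
    have := constant_of_has_deriv_right_zero hcont.continuousOn hderiv t ⟨ht, le_rfl⟩
    simpa using this
  refine ext_of_op_apply fun t x => ?_
  have hd : Dense {x | ∃ y, U.HasGenerator x y} := U.dense_setOf_hasGenerator
  have : (fun x => U.op t x) = fun x => V.op t x := by
    refine Continuous.ext_on hd (U.op t).continuous (V.op t).continuous ?_
    rintro x ⟨y, hxy⟩
    simpa using key t t.2 x y hxy
  exact congrFun this x

theorem mem_graph_generator_iff {U : C0Semigroup H} {x y : H} :
    (x, y) ∈ U.generator.graph ↔ U.HasGenerator x y := by
  rw [LinearPMap.mem_graph_iff]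
  constructor
  · rintro ⟨w, hw, hy⟩
    simp only at hw hy
    rw [← hw, ← hy]
    exact U.hasGenerator_generator w
  · intro h
    exact ⟨⟨x, y, h⟩, rfl, (U.hasGenerator_generator ⟨x, y, h⟩).unique h⟩

open scoped BoundedContinuousFunction

/-! ### Rescaling -/

/-- The semigroup `t ↦ exp (c t) U(t)`. -/
noncomputable def rescale (U : C0Semigroup H) (c : ℝ) : C0Semigroup H where
  op t := Real.exp (c * t) • U.op t
  op_zero := by simp [U.op_zero]
  op_add s t := by
    ext x
    simp [U.op_add, mul_add, Real.exp_add, smul_smul, mul_comm]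
  continuous_orbit x := by
    have := U.continuous_orbit x
    simp only [_root_.smul_apply]
    fun_prop

theorem realOp_rescale (U : C0Semigroup H) (c : ℝ) {t : ℝ} (ht : 0 ≤ t) :
    (U.rescale c).realOp t = Real.exp (c * t) • U.realOp t := by
  simp [realOp, rescale, ht]

theorem rescale_rescale_neg (U : C0Semigroup H) (c : ℝ) : (U.rescale c).rescale (-c) = U := by
  refine ext_of_op_apply fun t x => ?_
  simp [rescale, smul_smul, ← Real.exp_add]

theorem HasGenerator.rescale {U : C0Semigroup H} {x y : H} (h : U.HasGenerator x y) (c : ℝ) :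
    (U.rescale c).HasGenerator x (y + c • x) := by
  rw [hasGenerator_iff_hasDerivWithinAt] at h ⊢
  have he : HasDerivWithinAt (fun t : ℝ => Real.exp (c * t)) c (Ioi 0) 0 := by
    have := (((hasDerivAt_id (0 : ℝ)).const_mul c).exp).hasDerivWithinAt (s := Ioi 0)
    simpa using this
  have := he.smul h
  simp only [mul_zero, Real.exp_zero, one_smul, realOp_zero_apply] at this
  refine this.congr (fun t ht => ?_) (by simp)
  simp [U.realOp_rescale c (le_of_lt ht)]

theorem hasGenerator_rescale_iff {U : C0Semigroup H} {c : ℝ} {x y : H} :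
    (U.rescale c).HasGenerator x y ↔ U.HasGenerator x (y - c • x) := by
  constructor
  · intro h
    have := h.rescale (-c)
    rwa [rescale_rescale_neg, neg_smul, ← sub_eq_add_neg] at this
  · intro h
    simpa using h.rescale c

/-! ### Bounded perturbations -/

/-- The Duhamel integral `∫₀ᵗ U(t - s) B f(s) ds`, as a function of real `t`. For `t ≥ 0` the
truncations in `realOp` and `toNNReal` have no effect. -/
noncomputable def duhamel (U : C0Semigroup H) (B : H →L[ℂ] H) (f : ℝ≥0 → H) (t : ℝ) : H :=
  ∫ s in (0 : ℝ)..t, U.realOp (t - s) (B (f s.toNNReal))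

section

variable (U : C0Semigroup H) (B : H →L[ℂ] H)

theorem continuous_duhamel_integrand [CompleteSpace H] {f : ℝ≥0 → H} (hf : Continuous f) :
    Continuous fun p : ℝ × ℝ => U.realOp (p.1 - p.2) (B (f p.2.toNNReal)) :=
  U.continuous_realOp_comp (by fun_prop)
    (B.continuous.comp (hf.comp (continuous_real_toNNReal.comp continuous_snd)))

theorem intervalIntegrable_duhamel_integrand [CompleteSpace H] {f : ℝ≥0 → H}
    (hf : Continuous f) (t a b : ℝ) :
    IntervalIntegrable (fun s => U.realOp (t - s) (B (f s.toNNReal))) volume a b :=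
  ((U.continuous_duhamel_integrand B hf).comp (Continuous.prodMk_right t)).intervalIntegrable a b

theorem continuous_duhamel [CompleteSpace H] {f : ℝ≥0 → H} (hf : Continuous f) :
    Continuous (U.duhamel B f) :=
  intervalIntegral.continuous_parametric_intervalIntegral_of_continuous
    (U.continuous_duhamel_integrand B hf) continuous_id

@[simp]
theorem duhamel_zero (f : ℝ≥0 → H) : U.duhamel B f 0 = 0 := by
  simp [duhamel]

theorem duhamel_add [CompleteSpace H] {f g : ℝ≥0 → H} (hf : Continuous f)
    (hg : Continuous g) (t : ℝ) :
    U.duhamel B (f + g) t = U.duhamel B f t + U.duhamel B g t := by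
  simp only [duhamel, Pi.add_apply, map_add]
  exact intervalIntegral.integral_add (U.intervalIntegrable_duhamel_integrand B hf t _ _)
    (U.intervalIntegrable_duhamel_integrand B hg t _ _)

theorem duhamel_smul (c : ℂ) (f : ℝ≥0 → H) (t : ℝ) :
    U.duhamel B (c • f) t = c • U.duhamel B f t := by
  simp only [duhamel, Pi.smul_apply, map_smul]
  exact intervalIntegral.integral_smul c _

/-- Splitting the Duhamel integral at time `s`. -/
theorem duhamel_add_time [CompleteSpace H] {f : ℝ≥0 → H} (hf : Continuous f)
    {t : ℝ} (ht : 0 ≤ t) (s : ℝ≥0) :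
    U.duhamel B f (t + s) =
      U.realOp t (U.duhamel B f s) + U.duhamel B (fun r => f (r + s)) t := by
  have hint := U.intervalIntegrable_duhamel_integrand B hf
  rw [duhamel, ← intervalIntegral.integral_add_adjacent_intervals (hint _ _ s) (hint _ _ _)]
  congr 1
  · rw [duhamel, ← ContinuousLinearMap.intervalIntegral_comp_comm _ (hint _ _ _)]
    refine intervalIntegral.integral_congr fun r hr => ?_
    rw [uIcc_of_le s.coe_nonneg] at hr
    rw [← U.realOp_add_apply ht (sub_nonneg.2 hr.2), add_sub_assoc]
  · have hshift := intervalIntegral.integral_comp_add_right (a := 0) (b := t)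
      (fun r => U.realOp (t + s - r) (B (f r.toNNReal))) s
    rw [zero_add] at hshift
    rw [← hshift, duhamel]
    refine intervalIntegral.integral_congr fun r hr => ?_
    rw [uIcc_of_le ht] at hr
    simp [Real.toNNReal_add hr.1 s.coe_nonneg]

theorem hasDerivAt_duhamel_zero [CompleteSpace H] {f : ℝ≥0 → H} (hf : Continuous f) :
    HasDerivAt (U.duhamel B f) (B (f 0)) 0 := by
  rw [hasDerivAt_iff_isLittleO, Asymptotics.isLittleO_iff]
  intro ε hε
  have hF := (U.continuous_duhamel_integrand B hf).tendsto (0, 0)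
  obtain ⟨δ, hδ, hδF⟩ := (Metric.tendsto_nhds_nhds.1 hF) ε hε
  filter_upwards [Metric.ball_mem_nhds (0 : ℝ) hδ] with t ht
  have e : U.duhamel B f t - U.duhamel B f 0 - (t - 0) • B (f 0) =
      ∫ s in (0 : ℝ)..t, (U.realOp (t - s) (B (f s.toNNReal)) - B (f 0)) := by
    rw [intervalIntegral.integral_sub (U.intervalIntegrable_duhamel_integrand B hf t _ _)
      intervalIntegrable_const, intervalIntegral.integral_const]
    simp [duhamel]
  rw [e]
  refine intervalIntegral.norm_integral_le_of_norm_le_const fun s hs => ?_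
  have hs' : |s| ≤ |t| := by
    have h1 := uIoc_subset_uIcc hs
    have := abs_sub_left_of_mem_uIcc h1
    simpa using this
  have ht' : |t| < δ := by simpa using ht
  have hdist : dist (t, s) ((0, 0) : ℝ × ℝ) < δ := by
    simpa [Prod.dist_eq] using ⟨ht', hs'.trans_lt ht'⟩
  have := hδF hdist
  rw [dist_eq_norm] at this
  simpa using this.le

variable {U B} in
theorem norm_duhamel_le {M ω K : ℝ} (hω : 0 < ω)
    (hU : ∀ t, 0 ≤ t → ‖U.realOp t‖ ≤ M * Real.exp (-ω * t)) {f : ℝ≥0 → H}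
    (hfK : ∀ t, ‖f t‖ ≤ K) {t : ℝ} (ht : 0 ≤ t) :
    ‖U.duhamel B f t‖ ≤ M * ‖B‖ / ω * K := by
  have hM : 0 ≤ M := by simpa using (norm_nonneg _).trans (hU 0 le_rfl)
  have hK : 0 ≤ K := (norm_nonneg _).trans (hfK 0)
  have hd : ∀ s : ℝ, HasDerivAt (fun s => M * ‖B‖ / ω * K * Real.exp (-ω * (t - s)))
      (M * Real.exp (-ω * (t - s)) * (‖B‖ * K)) s := by
    intro s
    have h1 : HasDerivAt (fun s => -ω * (t - s)) ω s := by
      simpa using ((hasDerivAt_id s).const_sub t).const_mul (-ω)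
    refine (h1.exp.const_mul (M * ‖B‖ / ω * K)).congr_deriv ?_
    field_simp
  have hc : Continuous fun s => M * Real.exp (-ω * (t - s)) * (‖B‖ * K) := by fun_prop
  have h1 : ‖U.duhamel B f t‖ ≤ ∫ s in (0 : ℝ)..t, M * Real.exp (-ω * (t - s)) * (‖B‖ * K) := by
    refine intervalIntegral.norm_integral_le_of_norm_le ht (Eventually.of_forall fun s hs => ?_)
      (hc.intervalIntegrable _ _)
    refine (ContinuousLinearMap.le_opNorm _ _).trans ?_
    refine mul_le_mul (hU _ (sub_nonneg.2 hs.2)) ?_ (norm_nonneg _) (by positivity)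
    exact B.le_opNorm_of_le (hfK _)
  refine h1.trans ?_
  rw [intervalIntegral.integral_eq_sub_of_hasDerivAt (fun s _ => hd s) (hc.intervalIntegrable _ _)]
  have : 0 ≤ M * ‖B‖ / ω * K * Real.exp (-ω * (t - 0)) := by positivity
  simpa using this

end

/-- The bounded perturbation theorem for an exponentially stable semigroup whose decay dominates
the perturbation. The Volterra operator then has norm `< 1` on bounded continuous functions, and
the perturbed orbits solve `V(t) x = U(t) x + ∫₀ᵗ U(t - s) B V(s) x ds`. -/
theorem exists_perturbation_of_decay [CompleteSpace H] (U : C0Semigroup H) (B : H →L[ℂ] H)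
    {M ω : ℝ} (hω : 0 < ω) (hU : ∀ t, 0 ≤ t → ‖U.realOp t‖ ≤ M * Real.exp (-ω * t))
    (hB : M * ‖B‖ < ω) :
    ∃ V : C0Semigroup H, ∀ x y, V.HasGenerator x y ↔ U.HasGenerator x (y - B x) := by
  have hM : 0 ≤ M := by simpa using (norm_nonneg _).trans (hU 0 le_rfl)
  have hUM : ∀ t : ℝ≥0, ‖U.op t‖ ≤ M := fun t => by
    rw [← realOp_coe]
    refine (hU t t.2).trans (mul_le_of_le_one_right hM (Real.exp_le_one_iff.2 ?_))
    have := t.coe_nonneg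
    nlinarith
  -- The Volterra operator, and the map sending `x` to its unperturbed orbit.
  let K : (ℝ≥0 →ᵇ H) →L[ℂ] (ℝ≥0 →ᵇ H) := LinearMap.mkContinuous
    { toFun := fun f => BoundedContinuousFunction.ofNormedAddCommGroup
        (fun t : ℝ≥0 => U.duhamel B f t)
        ((U.continuous_duhamel B f.continuous).comp NNReal.continuous_coe) (M * ‖B‖ / ω * ‖f‖)
        (fun t => norm_duhamel_le hω hU f.norm_coe_le_norm t.2)
      map_add' := fun f g => by
        ext t
        exact U.duhamel_add B f.continuous g.continuous t
      map_smul' := fun c f => by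
        ext t
        exact U.duhamel_smul B c f t } (M * ‖B‖ / ω)
    fun f => BoundedContinuousFunction.norm_ofNormedAddCommGroup_le _ (by positivity)
      fun t => norm_duhamel_le hω hU f.norm_coe_le_norm t.2
  have hK_apply : ∀ f (t : ℝ≥0), K f t = U.duhamel B f t := fun f t => rfl
  have hK : ‖K‖ < 1 :=
    (LinearMap.mkContinuous_norm_le _ (by positivity) _).trans_lt ((div_lt_one hω).2 hB)
  let orb : H →L[ℂ] (ℝ≥0 →ᵇ H) := LinearMap.mkContinuous
    { toFun := fun x => BoundedContinuousFunction.ofNormedAddCommGroup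
        (fun t : ℝ≥0 => U.op t x) (U.continuous_orbit x) (M * ‖x‖)
        (fun t => (U.op t).le_of_opNorm_le (hUM t) x)
      map_add' := fun x y => by ext t; simp
      map_smul' := fun c x => by ext t; simp } M
    fun x => BoundedContinuousFunction.norm_ofNormedAddCommGroup_le _ (by positivity)
      fun t => (U.op t).le_of_opNorm_le (hUM t) x
  have horb_apply : ∀ x (t : ℝ≥0), orb x t = U.op t x := fun x t => rfl
  let R : (ℝ≥0 →ᵇ H) →L[ℂ] (ℝ≥0 →ᵇ H) := ↑(Units.oneSub K hK)⁻¹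
  have hR_left : ∀ f, R (f - K f) = f := fun f =>
    DFunLike.congr_fun (Units.inv_mul (Units.oneSub K hK)) f
  have hR_right : ∀ f, R f - K (R f) = f := fun f =>
    DFunLike.congr_fun (Units.mul_inv (Units.oneSub K hK)) f
  have hsol : ∀ x (t : ℝ≥0), R (orb x) t = U.op t x + U.duhamel B (R (orb x)) t := by
    intro x t
    have := DFunLike.congr_fun (hR_right (orb x)) t
    rw [BoundedContinuousFunction.sub_apply, hK_apply, horb_apply] at this
    exact sub_eq_iff_eq_add.1 this
  have hsol_zero : ∀ x, R (orb x) 0 = x := fun x => by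
    have := hsol x 0
    simpa [U.op_zero] using this
  let V : C0Semigroup H :=
    { op := fun t => (BoundedContinuousFunction.evalCLM ℂ t).comp (R.comp orb)
      op_zero := by
        ext x
        exact hsol_zero x
      op_add := fun t s => by
        ext x
        -- The orbit of `x` started at time `s` solves the equation for the initial value `V(s) x`.
        set f := R (orb x)
        let g : ℝ≥0 →ᵇ H := f.compContinuous ⟨fun r => r + s, by fun_prop⟩
        have hg : g - K g = orb (f s) := by
          ext r
          have h1 : f (r + s) = U.op (r + s) x + U.duhamel B f ((r + s : ℝ≥0) : ℝ) := hsol x (r + s)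
          have h2 : f s = U.op s x + U.duhamel B f s := hsol x s
          rw [NNReal.coe_add, U.duhamel_add_time B f.continuous r.coe_nonneg] at h1
          change f (r + s) - U.duhamel B (fun r => f (r + s)) r = U.op r (f s)
          rw [h1, h2, U.op_add, map_add, realOp_coe, ContinuousLinearMap.comp_apply]
          abel
        have h3 : R (orb (f s)) = g := by rw [← hg, hR_left]
        change f (t + s) = R (orb (f s)) t
        rw [h3]
        rfl
      continuous_orbit := fun x => (R (orb x)).continuous }
  have hV : ∀ x, ∀ t : ℝ, 0 ≤ t → V.realOp t x = U.realOp t x + U.duhamel B (R (orb x)) t := by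
    intro x t ht
    lift t to ℝ≥0 using ht
    rw [realOp_coe, realOp_coe]
    exact hsol x t
  have hD : ∀ x, HasDerivWithinAt (U.duhamel B (R (orb x))) (B x) (Ioi 0) 0 := fun x => by
    have := U.hasDerivAt_duhamel_zero B (R (orb x)).continuous
    rw [hsol_zero] at this
    exact this.hasDerivWithinAt
  refine ⟨V, fun x y => ?_⟩
  simp only [hasGenerator_iff_hasDerivWithinAt]
  constructor
  · intro h
    refine (h.sub (hD x)).congr (fun t ht => ?_) (by simp)
    simp [hV x t (le_of_lt ht)]
  · intro h
    have h' := h.add (hD x)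
    rw [sub_add_cancel] at h'
    refine h'.congr (fun t ht => ?_) (by simp)
    simp [hV x t (le_of_lt ht)]

/-- The bounded perturbation theorem: if `A` generates a strongly continuous semigroup and `B` is
bounded, then so does `A + B`, on the domain of `A`. -/
theorem exists_perturbation [CompleteSpace H] (U : C0Semigroup H) (B : H →L[ℂ] H) :
    ∃ V : C0Semigroup H, ∀ x y, V.HasGenerator x y ↔ U.HasGenerator x (y - B x) := by
  obtain ⟨M, ω, hM, hU⟩ := U.exists_norm_realOp_le_exp
  -- Rescale so that the decay rate `M ‖B‖ + 1` beats the perturbation.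
  set c : ℝ := -(ω + (M * ‖B‖ + 1))
  have hdecay : ∀ t, 0 ≤ t →
      ‖(U.rescale c).realOp t‖ ≤ M * Real.exp (-(M * ‖B‖ + 1) * t) := by
    intro t ht
    rw [U.realOp_rescale c ht, norm_smul, Real.norm_of_nonneg (Real.exp_pos _).le]
    calc Real.exp (c * t) * ‖U.realOp t‖ ≤ Real.exp (c * t) * (M * Real.exp (ω * t)) :=
          mul_le_mul_of_nonneg_left (hU t ht) (Real.exp_pos _).le
      _ = M * Real.exp (-(M * ‖B‖ + 1) * t) := by
          rw [mul_left_comm, ← Real.exp_add]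
          congr 2
          ring
  obtain ⟨V, hV⟩ := (U.rescale c).exists_perturbation_of_decay B (by positivity) hdecay
    (by linarith)
  refine ⟨V.rescale (-c), fun x y => ?_⟩
  rw [hasGenerator_rescale_iff, hV, hasGenerator_rescale_iff]
  have : y - (-c) • x - B x - c • x = y - B x := by
    rw [neg_smul]
    abel
  rw [this]

end C0Semigroup

/-! ### Products with bounded operators and the Mori projection -/

section Graph

variable {H : Type*} [NormedAddCommGroup H] [InnerProductSpace ℂ H]

theorem mem_graph_mulBounded_iff {A : H →ₗ.[ℂ] H} {B : H →L[ℂ] H} {x y : H} :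
    (x, y) ∈ (mulBounded A B).graph ↔ (B x, y) ∈ A.graph := by
  simp only [LinearPMap.mem_graph_iff]
  constructor
  · rintro ⟨w, rfl, rfl⟩
    exact ⟨⟨B w, w.2⟩, rfl, (mulBounded_apply A B w).symm⟩
  · rintro ⟨w, hw, rfl⟩
    have hx : x ∈ (mulBounded A B).domain := by
      change B x ∈ A.domain
      rw [← hw]
      exact w.2
    refine ⟨⟨x, hx⟩, rfl, ?_⟩
    rw [mulBounded_apply]
    congr 1
    exact Subtype.ext hw.symm

theorem mem_graph_boundedMul_iff {A : H →ₗ.[ℂ] H} {B : H →L[ℂ] H} {x y : H} :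
    (x, y) ∈ (boundedMul B A).graph ↔ ∃ w, (x, w) ∈ A.graph ∧ y = B w := by
  simp only [LinearPMap.mem_graph_iff]
  constructor
  · rintro ⟨v, rfl, rfl⟩
    exact ⟨A v, ⟨v, rfl, rfl⟩, rfl⟩
  · rintro ⟨_, ⟨v, rfl, rfl⟩, rfl⟩
    exact ⟨v, rfl, rfl⟩

theorem LinearPMap.IsClosed.closure_eq {A : H →ₗ.[ℂ] H} (hA : A.IsClosed) : A.closure = A := by
  refine LinearPMap.eq_of_eq_graph ?_
  rw [← hA.isClosable.graph_closure_eq_closure_graph]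
  exact IsClosed.submodule_topologicalClosure_eq hA

theorem moriQ_apply (z x : H) : moriQ z x = x - moriP z x := rfl

theorem moriP_self {z : H} (hz : z ≠ 0) : moriP z z = z := by
  rw [moriP_apply, mul_inv_cancel₀ (inner_self_ne_zero.2 hz), one_smul]

theorem moriQ_self {z : H} (hz : z ≠ 0) : moriQ z z = 0 := by
  rw [moriQ_apply, moriP_self hz, sub_self]

theorem moriQ_moriP {z : H} (hz : z ≠ 0) (x : H) : moriQ z (moriP z x) = 0 := by
  rw [moriP_apply, map_smul, moriQ_self hz, smul_zero]

theorem moriP_moriP {z : H} (hz : z ≠ 0) (x : H) : moriP z (moriP z x) = moriP z x :=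
  (sub_eq_zero.1 (moriQ_moriP hz x)).symm

theorem moriP_moriQ {z : H} (hz : z ≠ 0) (x : H) : moriP z (moriQ z x) = 0 := by
  rw [moriQ_apply, map_sub, moriP_moriP hz, sub_self]

end Graph

namespace C0Semigroup

variable {H : Type*} [NormedAddCommGroup H] [InnerProductSpace ℂ H]

/-! ### Operators as generators -/

theorem generator_eq_iff {V : C0Semigroup H} {A : H →ₗ.[ℂ] H} :
    V.generator = A ↔ ∀ x y, V.HasGenerator x y ↔ (x, y) ∈ A.graph := by
  constructor
  · rintro rfl x y
    exact mem_graph_generator_iff.symm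
  · intro h
    refine LinearPMap.eq_of_eq_graph (Submodule.ext fun p => ?_)
    exact mem_graph_generator_iff.trans (h p.1 p.2)

theorem generator_injective [CompleteSpace H] {V W : C0Semigroup H}
    (h : V.generator = W.generator) : V = W :=
  eq_of_hasGenerator_imp fun _ _ hxy =>
    mem_graph_generator_iff.1 (h ▸ mem_graph_generator_iff.2 hxy)

/-- An operator `A` with `A = L + D` on `D(A) = D(L)` and `D` bounded generates exactly one
strongly continuous semigroup. -/
theorem existsUnique_generator_eq [CompleteSpace H] {U : C0Semigroup H} {A : H →ₗ.[ℂ] H}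
    {D : H →L[ℂ] H} (hD : ∀ x y, (x, y) ∈ A.graph ↔ U.HasGenerator x (y - D x)) :
    ∃! V : C0Semigroup H, V.generator = A := by
  obtain ⟨V, hV⟩ := U.exists_perturbation D
  have hVA : V.generator = A :=
    generator_eq_iff.2 fun x y => (hV x y).trans (hD x y).symm
  exact ⟨V, hVA, fun W hW => generator_injective (hW.trans hVA.symm)⟩

theorem dense_generator_domain [CompleteSpace H] (U : C0Semigroup H) :
    Dense (U.generator.domain : Set H) :=
  U.dense_setOf_hasGenerator

theorem op_apply_eq_self [CompleteSpace H] {U : C0Semigroup H} {x : H} (h : U.HasGenerator x 0)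
    (t : ℝ≥0) : U.op t x = x := by
  have := h.integral_eq t.2
  rw [← realOp_coe]
  simp only [map_zero, intervalIntegral.integral_zero] at this
  exact sub_eq_zero.1 this.symm

/-! ### The projected semigroup `P + Q S(t)` -/

/-- The family `P + Q S(t)`, a semigroup as soon as `S` fixes `z`. -/
noncomputable def projected (S : C0Semigroup H) {z : H} (hz : z ≠ 0)
    (hS : ∀ t, S.op t z = z) : C0Semigroup H where
  op t := moriP z + (moriQ z).comp (S.op t)
  op_zero := by
    ext x
    simp [S.op_zero, moriQ_apply]
  op_add s t := by
    ext x
    have hSP : ∀ t y, S.op t (moriP z y) = moriP z y := fun t y => by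
      rw [moriP_apply, map_smul, hS]
    have h : moriQ z (S.op s (moriQ z (S.op t x))) = moriQ z (S.op s (S.op t x)) := by
      rw [moriQ_apply z (S.op t x), map_sub, map_sub, hSP, moriQ_moriP hz, sub_zero]
    simp [S.op_add, hSP, h, moriP_moriP hz, moriP_moriQ hz, moriQ_moriP hz]
  continuous_orbit x := by
    have := S.continuous_orbit x
    simp only [_root_.add_apply, ContinuousLinearMap.comp_apply]
    fun_prop

theorem HasGenerator.projected {S : C0Semigroup H} {x y z : H} (hz : z ≠ 0)
    (hS : ∀ t, S.op t z = z) (h : S.HasGenerator x y) :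
    (S.projected hz hS).HasGenerator x (moriQ z y) := by
  refine (((moriQ z).continuous.tendsto y).comp h).congr fun t => ?_
  have e : (S.projected hz hS).op t x - x = moriQ z (S.op t x - x) := by
    change moriP z x + moriQ z (S.op t x) - x = _
    rw [map_sub, moriQ_apply z x]
    abel
  rw [e, Function.comp_apply, map_smul]

/-! ### The operators `QL`, `LQ` and `QLQ` as bounded perturbations -/

/-- On `D(L)`, the operator `L Q` is `L - L P`, and `L P` has rank one. -/
theorem mem_graph_mulBounded_moriQ_iff {U : C0Semigroup H} {z z' : H}
    (h : U.HasGenerator z z') {x y : H} :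
    (x, y) ∈ (mulBounded U.generator (moriQ z)).graph ↔
      U.HasGenerator x (y + (inner ℂ z x * (inner ℂ z z)⁻¹) • z') := by
  rw [mem_graph_mulBounded_iff, mem_graph_generator_iff]
  have hP := h.smul (inner ℂ z x * (inner ℂ z z)⁻¹)
  rw [← moriP_apply] at hP
  constructor
  · intro hQ
    have := hQ.add hP
    rwa [moriQ_apply, sub_add_cancel] at this
  · intro hx
    have := hx.add (hP.smul (-1))
    rwa [neg_one_smul, neg_one_smul, add_neg_cancel_right, ← sub_eq_add_neg, ← moriQ_apply] at this

/-- If `w = L† z`, then `P L` agrees on `D(L)` with the bounded operator `x ↦ (x, w) (z, z)⁻¹ z`,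
so that `Q L = L - P L` is a bounded perturbation of `L`. -/
theorem mem_graph_boundedMul_moriQ_iff {U : C0Semigroup H} {z w : H}
    (hw : ∀ x y, U.HasGenerator x y → inner ℂ w x = inner ℂ z y) {x y : H} :
    (x, y) ∈ (boundedMul (moriQ z) U.generator).graph ↔
      U.HasGenerator x (y + (inner ℂ w x * (inner ℂ z z)⁻¹) • z) := by
  rw [mem_graph_boundedMul_iff]
  constructor
  · rintro ⟨v, hv, rfl⟩
    rw [mem_graph_generator_iff] at hv
    rwa [hw _ _ hv, ← moriP_apply, moriQ_apply, sub_add_cancel]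
  · intro h
    refine ⟨_, mem_graph_generator_iff.2 h, ?_⟩
    rw [moriQ_apply, moriP_apply, ← hw _ _ h, add_sub_cancel_right]

theorem isClosed_boundedMul_moriQ [CompleteSpace H] {U : C0Semigroup H} {z w : H}
    (hw : ∀ x y, U.HasGenerator x y → inner ℂ w x = inner ℂ z y) :
    (boundedMul (moriQ z) U.generator).IsClosed := by
  have e : ((boundedMul (moriQ z) U.generator).graph : Set (H × H)) =
      (fun p : H × H => (p.1, p.2 + (inner ℂ w p.1 * (inner ℂ z z)⁻¹) • z)) ⁻¹'
        {p | U.HasGenerator p.1 p.2} :=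
    Set.ext fun p => mem_graph_boundedMul_moriQ_iff hw
  rw [LinearPMap.IsClosed, e]
  exact U.isClosed_setOf_hasGenerator.preimage (by fun_prop)

end C0Semigroup

/-! ### The semigroups generated by `Q L Q` and `L Q` -/

theorem mainTheorem8 {H : Type*} [NormedAddCommGroup H] [InnerProductSpace ℂ H]
    [CompleteSpace H] (U : C0Semigroup H) (z : H) (hz : z ≠ 0)
    (hzL : z ∈ U.generator.domain) (hzL' : z ∈ U.generator.adjoint.domain) :
    (boundedMul (moriQ z) U.generator).IsClosable ∧
    (∃! G : C0Semigroup H,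
      G.generator = mulBounded (boundedMul (moriQ z) U.generator).closure (moriQ z)) ∧
    (∃! S : C0Semigroup H, S.generator = mulBounded U.generator (moriQ z)) ∧
    ∀ G S : C0Semigroup H,
      G.generator = mulBounded (boundedMul (moriQ z) U.generator).closure (moriQ z) →
      S.generator = mulBounded U.generator (moriQ z) →
      ∀ t : ℝ≥0, G.op t = moriP z + (moriQ z).comp (S.op t) := by
  obtain ⟨z', hz'⟩ := hzL
  set w : H := U.generator.adjoint ⟨z, hzL'⟩
  have hw : ∀ x y, U.HasGenerator x y → inner ℂ w x = inner ℂ z y := by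
    intro x y hxy
    have := LinearPMap.adjoint_isFormalAdjoint U.dense_generator_domain ⟨z, hzL'⟩ ⟨x, y, hxy⟩
    rwa [(U.hasGenerator_generator ⟨x, y, hxy⟩).unique hxy] at this
  have hclosed := C0Semigroup.isClosed_boundedMul_moriQ hw
  rw [hclosed.closure_eq]
  -- Rank-one operators with `L Q = L + B` and `Q L = L + C`, hence `Q L Q = L + (B + C Q)`.
  let B : H →L[ℂ] H := -((inner ℂ z z)⁻¹ • (innerSL ℂ z).smulRight z')
  have hB : ∀ x, B x = -((inner ℂ z x * (inner ℂ z z)⁻¹) • z') := fun x => by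
    simp [B, smul_smul, mul_comm]
  let C : H →L[ℂ] H := -((inner ℂ z z)⁻¹ • (innerSL ℂ w).smulRight z)
  have hC : ∀ x, C x = -((inner ℂ w x * (inner ℂ z z)⁻¹) • z) := fun x => by
    simp [C, smul_smul, mul_comm]
  have hLQ : ∀ x y, (x, y) ∈ (mulBounded U.generator (moriQ z)).graph ↔
      U.HasGenerator x (y - B x) := fun x y => by
    rw [C0Semigroup.mem_graph_mulBounded_moriQ_iff hz', hB, sub_neg_eq_add]
  have hQLQ : ∀ x y,
      (x, y) ∈ (mulBounded (boundedMul (moriQ z) U.generator) (moriQ z)).graph ↔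
        U.HasGenerator x (y - (B + C.comp (moriQ z)) x) := fun x y => by
    rw [mem_graph_mulBounded_iff, C0Semigroup.mem_graph_boundedMul_moriQ_iff hw,
      ← C0Semigroup.mem_graph_generator_iff, ← mem_graph_mulBounded_iff, hLQ,
      ← sub_neg_eq_add, ← hC, sub_sub, add_comm (C _)]
    rfl
  refine ⟨hclosed.isClosable,
    C0Semigroup.existsUnique_generator_eq hQLQ, C0Semigroup.existsUnique_generator_eq hLQ,
    fun G S hG hS => ?_⟩
  rw [C0Semigroup.generator_eq_iff] at hG hS
  -- `L Q z = 0`, so `S` fixes `z`.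
  have hSz : ∀ t, S.op t z = z := by
    refine C0Semigroup.op_apply_eq_self ((hS z 0).2 ?_)
    rw [mem_graph_mulBounded_iff, moriQ_self hz]
    exact Submodule.zero_mem _
  -- If `Q x ∈ D(L)`, then the generator of `P + Q S` sends `x` to `Q (L Q x)`.
  have hGS : G = S.projected hz hSz := by
    refine C0Semigroup.eq_of_hasGenerator_imp fun x y hxy => ?_
    rw [hG, mem_graph_mulBounded_iff, mem_graph_boundedMul_iff] at hxy
    obtain ⟨v, hv, rfl⟩ := hxy
    exact ((hS x v).2 (mem_graph_mulBounded_iff.2 hv)).projected hz hSz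
  intro t
  rw [hGS]
  rfl
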